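/- Let $0 \le m \le n$ be integers, and for $0\le k\le n$ let $G(n,k)$ be the Grassmannian of $k$-dimensional linear subspaces of $\mathbb{R}^n$, with $\gamma_{n,k}$ the $O(n)$-invariant Borel probability measure on $G(n,k)$. Let $\dim$ denote Hausdorff dimension. If $A \subset \mathbb{R}^n$ is a Borel set with $\dim A > m$, then for every $x \in \mathbb{R}^n$, $$\dim\bigl(A \cap (V+x)\bigr) \le \dim A - m \quad \text{for } \gamma_{n,n-m}\text{-almost every } V \in G(n,n-m).$$ -/

import Mathlib

open Set MeasureTheory Topology

noncomputable section

/-- The Grassmannian `G(n,k)` of `k`-dimensional linear subspaces of Euclidean `n`-space. -/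
def Grassmann (n k : ℕ) : Type :=
  {V : Submodule ℝ (EuclideanSpace ℝ (Fin n)) // Module.finrank ℝ V = k}

namespace Grassmann

variable {n k : ℕ}

/-- The orthogonal projection of `ℝⁿ` onto `V`, as an operator on `ℝⁿ`. -/
def proj (V : Grassmann n k) : EuclideanSpace ℝ (Fin n) →L[ℝ] EuclideanSpace ℝ (Fin n) :=
  V.1.starProjection

theorem proj_injective :
    Function.Injective (proj : Grassmann n k → _) := by
  intro V W h
  exact Subtype.ext (Submodule.starProjection_inj.mp h)

/-- The usual metric `d(V,W) = ‖P_V - P_W‖` on `G(n,k)`. -/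
instance : MetricSpace (Grassmann n k) := MetricSpace.induced proj proj_injective inferInstance

/-- The Borel σ-algebra of `G(n,k)`. -/
instance : MeasurableSpace (Grassmann n k) := borel _

instance : BorelSpace (Grassmann n k) := ⟨rfl⟩

end Grassmann

/-- The orthogonal group `O(n)`: linear operators `g` on `ℝⁿ` with `g* g = g g* = 1`, with the
topology given by the operator norm. -/
abbrev OrthGroup (n : ℕ) : Type :=
  unitary (EuclideanSpace ℝ (Fin n) →L[ℝ] EuclideanSpace ℝ (Fin n))

namespace OrthGroup

variable {n k : ℕ}

instance : ContinuousStar (EuclideanSpace ℝ (Fin n) →L[ℝ] EuclideanSpace ℝ (Fin n)) :=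
  ⟨(ContinuousLinearMap.adjoint (𝕜 := ℝ) (E := EuclideanSpace ℝ (Fin n))
    (F := EuclideanSpace ℝ (Fin n))).continuous⟩

instance : CompactSpace (OrthGroup n) := by
  refine (isCompact_iff_compactSpace (s := (unitary (EuclideanSpace ℝ (Fin n) →L[ℝ]
    EuclideanSpace ℝ (Fin n)) : Set (EuclideanSpace ℝ (Fin n) →L[ℝ]
      EuclideanSpace ℝ (Fin n))))).mp ?_
  haveI : ProperSpace (EuclideanSpace ℝ (Fin n) →L[ℝ] EuclideanSpace ℝ (Fin n)) :=
    FiniteDimensional.proper ℝ _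
  refine Metric.isCompact_of_isClosed_isBounded isClosed_unitary ?_
  · refine (Metric.isBounded_closedBall (x := 0) (r := 1)).subset fun g hg => ?_
    rw [mem_closedBall_zero_iff]
    refine ContinuousLinearMap.opNorm_le_bound _ zero_le_one fun x => ?_
    have := (Unitary.linearIsometryEquiv ⟨g, hg⟩).norm_map x
    rw [one_mul]
    exact this.le

/-- The Haar measure on `O(n)`, with total mass one. -/
def haar (n : ℕ) : Measure (OrthGroup n) := Measure.haarMeasure ⊤

instance : IsProbabilityMeasure (haar n) :=
  ⟨Measure.haarMeasure_self (K₀ := (⊤ : TopologicalSpace.PositiveCompacts (OrthGroup n)))⟩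

/-- The action of `O(n)` on `G(n,k)`: `g` sends `V` to its image `g(V)`. -/
def act (g : OrthGroup n) (V : Grassmann n k) : Grassmann n k :=
  ⟨V.1.map (Unitary.linearIsometryEquiv g).toLinearEquiv.toLinearMap, by
    rw [LinearEquiv.finrank_map_eq]; exact V.2⟩

theorem proj_act (g : OrthGroup n) (V : Grassmann n k) :
    (act g V).proj = (g : EuclideanSpace ℝ (Fin n) →L[ℝ] EuclideanSpace ℝ (Fin n)) * V.proj *
      star (g : EuclideanSpace ℝ (Fin n) →L[ℝ] EuclideanSpace ℝ (Fin n)) := by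
  ext1 x
  exact Submodule.starProjection_map_apply (Unitary.linearIsometryEquiv g) V.1 x

theorem continuous_act (V : Grassmann n k) : Continuous fun g : OrthGroup n => act g V := by
  have : IsInducing (Grassmann.proj : Grassmann n k → _) := ⟨rfl⟩
  rw [this.continuous_iff]
  have h : (Grassmann.proj ∘ fun g : OrthGroup n => act g V) = fun g : OrthGroup n =>
      (g : EuclideanSpace ℝ (Fin n) →L[ℝ] EuclideanSpace ℝ (Fin n)) * V.proj *
      star (g : EuclideanSpace ℝ (Fin n) →L[ℝ] EuclideanSpace ℝ (Fin n)) :=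
    funext fun g => proj_act g V
  rw [h]
  fun_prop

end OrthGroup

namespace Grassmann

/-- The coordinate `k`-plane spanned by the first `k` standard basis vectors of `ℝⁿ`. -/
def coordPlane (n k : ℕ) (hk : k ≤ n) : Grassmann n k :=
  ⟨Submodule.span ℝ (range fun i : Fin k => EuclideanSpace.single (Fin.castLE hk i) (1 : ℝ)), by
    have h := ((EuclideanSpace.basisFun (Fin n) ℝ).orthonormal.linearIndependent).comp
      (Fin.castLE hk) (Fin.castLE_injective hk)
    rw [show (fun i : Fin k => EuclideanSpace.single (Fin.castLE hk i) (1 : ℝ)) =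
      (EuclideanSpace.basisFun (Fin n) ℝ) ∘ Fin.castLE hk from
        funext fun i => (EuclideanSpace.basisFun_apply (Fin n) ℝ _).symm]
    exact (finrank_span_eq_card h).trans (Fintype.card_fin k)⟩

/-- The measure `γ_{n,k}` on `G(n,k)`: the image of the normalised Haar measure of `O(n)` under
`g ↦ g(V₀)`, where `V₀` is a coordinate `k`-plane. It is the unique `O(n)`-invariant Borel
probability measure on `G(n,k)`. -/
def gamma (n k : ℕ) (hk : k ≤ n) : Measure (Grassmann n k) :=
  (OrthGroup.haar n).map fun g => OrthGroup.act g (coordPlane n k hk)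

/-- The map defining `gamma` is measurable, so `gamma` has total mass one. -/
instance (n k : ℕ) (hk : k ≤ n) : IsProbabilityMeasure (gamma n k hk) :=
  Measure.isProbabilityMeasure_map (OrthGroup.continuous_act _).measurable.aemeasurable

end Grassmann

end

/-!
A random `k`-plane through the origin of `ℝⁿ` comes within `r` of a point `y` with probability
`O(r ^ (n - k))`, uniformly for `‖y‖ ≥ δ`: by invariance and scaling this probability is at most its
average over the ball of radius `δ`, which Tonelli turns into the volume of a slab of width `r`
around a plane. Hence the expected value of `∑ (diam E) ^ d` over the members `E` of a cover that
are met by the plane is at most a constant times `∑ (diam E) ^ (n - k + d)`. Taking ever more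
economical covers, Fatou's lemma shows that a set `A` of zero `(n - k + d)`-dimensional measure away
from the origin has sections of zero `d`-dimensional measure almost surely. The origin itself, a
single point, does not affect the dimension.
-/

open Filter Module
open scoped ENNReal NNReal MeasureTheory

section Slicing

variable {X Ω : Type*} [MeasurableSpace Ω] {μ : Measure Ω}

theorem ae_liminf_eq_zero_of_tendsto_lintegral {f : ℕ → Ω → ℝ≥0∞} (hf : ∀ N, Measurable (f N))
    (h : Tendsto (fun N => ∫⁻ ω, f N ω ∂μ) atTop (𝓝 0)) :
    ∀ᵐ ω ∂μ, liminf (fun N => f N ω) atTop = 0 :=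
  (lintegral_eq_zero_iff (.liminf hf)).mp <|
    le_antisymm ((lintegral_liminf_le hf).trans_eq h.liminf_eq) zero_le

variable [EMetricSpace X]

/-- The random set `S` meets the bounded subsets `E` of `A` with `μ`-measure `O((diam E) ^ s)`.
This is the only property of a random plane through the origin that the slicing estimate uses. The
hitting events need not be measurable, so `μ` stands for the outer measure here. -/
def HasHittingExponent (μ : Measure Ω) (S : Ω → Set X) (A : Set X) (s : ℝ≥0) : Prop :=
  ∃ C : ℝ≥0∞, C ≠ ∞ ∧ ∀ E ⊆ A, Metric.ediam E ≠ ∞ →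
    μ {ω | (E ∩ S ω).Nonempty} ≤ C * Metric.ediam E ^ (s : ℝ)

theorem HasHittingExponent.mono {S : Ω → Set X} {A B : Set X} {s : ℝ≥0}
    (hS : HasHittingExponent μ S A s) (hB : B ⊆ A) : HasHittingExponent μ S B s :=
  let ⟨C, hC, hhit⟩ := hS
  ⟨C, hC, fun E hE => hhit E (hE.trans hB)⟩

theorem exists_measurable_tsum_ediam_inter_le {ι : Type*} [Countable ι] {S : Ω → Set X}
    {E : ι → Set X} {C : ℝ≥0∞} {s d : ℝ≥0} (hd : 0 < d)
    (hE : ∀ i, μ {ω | (E i ∩ S ω).Nonempty} ≤ C * Metric.ediam (E i) ^ (s : ℝ)) :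
    ∃ g : Ω → ℝ≥0∞, Measurable g ∧ (∀ ω, ∑' i, Metric.ediam (E i ∩ S ω) ^ (d : ℝ) ≤ g ω) ∧
      ∫⁻ ω, g ω ∂μ ≤ C * ∑' i, Metric.ediam (E i) ^ ((s + d : ℝ≥0) : ℝ) := by
  let hit (i : ι) : Set Ω := toMeasurable μ {ω | (E i ∩ S ω).Nonempty}
  have hmeas (i : ι) : Measurable ((hit i).indicator fun _ => Metric.ediam (E i) ^ (d : ℝ)) :=
    measurable_const.indicator (measurableSet_toMeasurable _ _)
  refine ⟨fun ω => ∑' i, (hit i).indicator (fun _ => Metric.ediam (E i) ^ (d : ℝ)) ω,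
    .tsum hmeas, fun ω => ENNReal.tsum_le_tsum fun i => ?_, ?_⟩
  · rcases (E i ∩ S ω).eq_empty_or_nonempty with hempty | hne
    · simp [hempty, hd]
    · rw [indicator_of_mem (subset_toMeasurable μ _ hne)]
      gcongr
      exact inter_subset_left
  · rw [lintegral_tsum fun i => (hmeas i).aemeasurable, ← ENNReal.tsum_mul_left]
    refine ENNReal.tsum_le_tsum fun i => ?_
    calc ∫⁻ ω, (hit i).indicator (fun _ => Metric.ediam (E i) ^ (d : ℝ)) ω ∂μ
        = Metric.ediam (E i) ^ (d : ℝ) * μ {ω | (E i ∩ S ω).Nonempty} := by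
          rw [lintegral_indicator_const (measurableSet_toMeasurable _ _), measure_toMeasurable]
      _ ≤ Metric.ediam (E i) ^ (d : ℝ) * (C * Metric.ediam (E i) ^ (s : ℝ)) := by
          gcongr
          exact hE i
      _ = C * Metric.ediam (E i) ^ ((s + d : ℝ≥0) : ℝ) := by
          rw [NNReal.coe_add, ENNReal.rpow_add_of_nonneg _ _ s.coe_nonneg d.coe_nonneg]
          ring

variable [MeasurableSpace X] [BorelSpace X]

theorem exists_cover_of_hausdorffMeasure_eq_zero {A : Set X} {t : ℝ} (ht : 0 < t)
    (h : μH[t] A = 0) {ε : ℝ≥0∞} (hε : 0 < ε) :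
    ∃ E : ℕ → Set X, A ⊆ ⋃ i, E i ∧ (∀ i, Metric.ediam (E i) ≤ ε) ∧
      ∑' i, Metric.ediam (E i) ^ t ≤ ε := by
  simp only [Measure.hausdorffMeasure_apply, ENNReal.iSup_eq_zero] at h
  have hlt := (h ε hε).trans_lt hε
  simp only [iInf_lt_iff] at hlt
  obtain ⟨E, hAE, hdiam, hsum⟩ := hlt
  refine ⟨E, hAE, hdiam, (ENNReal.tsum_le_tsum fun i => ?_).trans hsum.le⟩
  rcases (E i).eq_empty_or_nonempty with hempty | hne
  · simp [hempty, ht]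
  · simp [hne]

namespace HasHittingExponent

variable {S : Ω → Set X} {A : Set X} {s : ℝ≥0}

theorem ae_hausdorffMeasure_inter_eq_zero (hS : HasHittingExponent μ S A s) {d : ℝ≥0} (hd : 0 < d)
    (hA : μH[(s + d : ℝ≥0)] A = 0) : ∀ᵐ ω ∂μ, μH[d] (A ∩ S ω) = 0 := by
  obtain ⟨C, hC, hhit⟩ := hS
  let ε (N : ℕ) : ℝ≥0∞ := (N + 1 : ℕ)⁻¹
  have hε : Tendsto ε atTop (𝓝 0) :=
    (tendsto_add_atTop_iff_nat 1).mpr ENNReal.tendsto_inv_nat_nhds_zero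
  have hCε : Tendsto (fun N => C * ε N) atTop (𝓝 0) := by
    simpa using ENNReal.Tendsto.const_mul hε (.inr hC)
  choose E hAE hdiam hsum using fun N =>
    exists_cover_of_hausdorffMeasure_eq_zero (NNReal.coe_pos.mpr (add_pos_of_nonneg_of_pos s.2 hd))
      hA (ε := ε N) (by simp [ε])
  have hdiam' (N i) : Metric.ediam (A ∩ E N i) ≤ ε N :=
    (Metric.ediam_mono inter_subset_right).trans (hdiam N i)
  choose g hgm hg hgint using fun N => exists_measurable_tsum_ediam_inter_le hd fun i =>
    hhit (A ∩ E N i) inter_subset_left ((hdiam' N i).trans_lt (by simp [ε])).ne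
  have hgε (N) : ∫⁻ ω, g N ω ∂μ ≤ C * ε N := by
    refine (hgint N).trans ?_
    gcongr
    refine le_trans (ENNReal.tsum_le_tsum fun i => ?_) (hsum N)
    gcongr
    exact inter_subset_right
  filter_upwards [ae_liminf_eq_zero_of_tendsto_lintegral hgm
    (tendsto_of_tendsto_of_tendsto_of_le_of_le tendsto_const_nhds hCε (fun _ => zero_le) hgε)]
    with ω hω
  refine le_antisymm ?_ zero_le
  calc μH[d] (A ∩ S ω)
      ≤ liminf (fun N => ∑' i, Metric.ediam (A ∩ E N i ∩ S ω) ^ (d : ℝ)) atTop := by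
        refine Measure.hausdorffMeasure_le_liminf_tsum d _ ε hε _
          (.of_forall fun N i => (Metric.ediam_mono inter_subset_left).trans (hdiam' N i))
          (.of_forall fun N => ?_)
        rw [← iUnion_inter, ← inter_iUnion, inter_eq_left.mpr (hAE N)]
    _ ≤ liminf (fun N => g N ω) atTop := liminf_le_liminf (.of_forall fun N => hg N ω)
    _ = 0 := hω

theorem ae_dimH_inter_le (hS : HasHittingExponent μ S A s) :
    ∀ᵐ ω ∂μ, dimH (A ∩ S ω) ≤ dimH A - s := by
  have hle (q : ℚ) : ∀ᵐ ω ∂μ, dimH A - s < (q : ℝ).toNNReal →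
      dimH (A ∩ S ω) ≤ (q : ℝ).toNNReal := by
    by_cases hq : dimH A - s < (q : ℝ).toNNReal
    · have hdim : dimH A < (s + (q : ℝ).toNNReal : ℝ≥0) := by
        rw [ENNReal.coe_add, add_comm]
        exact ENNReal.cancel_coe.lt_add_of_tsub_lt_right hq
      filter_upwards [hS.ae_hausdorffMeasure_inter_eq_zero
        (ENNReal.coe_pos.mp (pos_of_gt hq)) (hausdorffMeasure_of_dimH_lt hdim)] with ω hω _
      exact dimH_le_of_hausdorffMeasure_ne_top (hω.trans_ne ENNReal.zero_ne_top)
    · simp [hq]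
  filter_upwards [ae_all_iff.mpr hle] with ω hω
  refine le_of_forall_gt_imp_ge_of_dense fun d hd => ?_
  obtain ⟨q, -, hAq, hqd⟩ := ENNReal.lt_iff_exists_rat_btwn.mp hd
  exact (hω q hAq).trans hqd.le

end HasHittingExponent

end Slicing

section Volume

variable {F : Type*} [NormedAddCommGroup F] [InnerProductSpace ℝ F] [FiniteDimensional ℝ F]
  [MeasurableSpace F] [BorelSpace F]

theorem volume_closedBall_le_ofReal_two_mul_pow_finrank (x : F) (r : ℝ) :
    volume (Metric.closedBall x r) ≤ ENNReal.ofReal (2 * r) ^ finrank ℝ F := by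
  rcases lt_or_ge r 0 with hr | hr
  · simp [Metric.closedBall_eq_empty.mpr hr]
  let b := stdOrthonormalBasis ℝ F
  have hcoord : MeasurePreserving fun y : F => (b.repr y).ofLp :=
    (PiLp.volume_preserving_ofLp _).comp b.measurePreserving_repr
  calc volume (Metric.closedBall x r)
      ≤ volume ((fun y : F => (b.repr y).ofLp) ⁻¹' Metric.closedBall (b.repr x).ofLp r) := by
        refine measure_mono fun y hy => ?_
        refine (PiLp.lipschitzWith_ofLp 2 _ |>.dist_le_mul _ _).trans ?_
        simpa using hy
    _ = ENNReal.ofReal (2 * r) ^ finrank ℝ F := by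
        rw [hcoord.measure_preimage Metric.isClosed_closedBall.nullMeasurableSet,
          Real.volume_pi_closedBall _ hr, Fintype.card_fin, ENNReal.ofReal_pow (by positivity)]

theorem volume_closedBall_inter_norm_sub_starProjection_le (V : Submodule ℝ F) (R r : ℝ) :
    volume (Metric.closedBall 0 R ∩ {y | ‖y - V.starProjection y‖ ≤ r}) ≤
      ENNReal.ofReal (2 * R) ^ finrank ℝ V * ENNReal.ofReal (2 * r) ^ finrank ℝ Vᗮ := by
  have hsplit : MeasurePreserving fun y : F => (V.orthogonalDecomposition y).ofLp :=
    (WithLp.volume_preserving_ofLp _ _).comp V.orthogonalDecomposition.measurePreserving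
  calc volume (Metric.closedBall 0 R ∩ {y | ‖y - V.starProjection y‖ ≤ r})
      ≤ volume ((fun y : F => (V.orthogonalDecomposition y).ofLp) ⁻¹'
          Metric.closedBall 0 R ×ˢ Metric.closedBall 0 r) := by
        refine measure_mono fun y ⟨hyR, hyr⟩ => ⟨?_, ?_⟩
        · simpa using (V.norm_orthogonalProjectionOnto_apply_le y).trans
            (mem_closedBall_zero_iff.mp hyR)
        · rw [mem_ofPred_eq, ← Submodule.starProjection_orthogonal_val] at hyr
          simpa using hyr
    _ ≤ _ := by
        rw [hsplit.measure_preimage (Metric.isClosed_closedBall.prod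
          Metric.isClosed_closedBall).nullMeasurableSet, Measure.volume_eq_prod, Measure.prod_prod]
        gcongr <;> exact volume_closedBall_le_ofReal_two_mul_pow_finrank 0 _

end Volume

theorem exists_unitary_apply_eq_of_norm_eq {F : Type*} [NormedAddCommGroup F]
    [InnerProductSpace ℝ F] [CompleteSpace F] {y z : F} (h : ‖y‖ = ‖z‖) :
    ∃ u : unitary (F →L[ℝ] F), Unitary.linearIsometryEquiv u y = z :=
  ⟨Unitary.linearIsometryEquiv.symm (Submodule.span ℝ {y - z})ᗮ.reflection, by
    rw [MulEquiv.apply_symm_apply, Submodule.reflection_sub h]⟩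

namespace Grassmann

variable {n k : ℕ}

theorem continuous_proj :
    Continuous (proj : Grassmann n k → EuclideanSpace ℝ (Fin n) →L[ℝ] EuclideanSpace ℝ (Fin n)) :=
  continuous_induced_dom

theorem continuous_proj_apply :
    Continuous fun p : EuclideanSpace ℝ (Fin n) × Grassmann n k => p.2.proj p.1 :=
  (continuous_proj.comp continuous_snd).clm_apply continuous_fst

theorem norm_sub_proj_le_dist (V : Grassmann n k) (y : EuclideanSpace ℝ (Fin n))
    {z : EuclideanSpace ℝ (Fin n)} (hz : z ∈ V.1) : ‖y - V.proj y‖ ≤ dist y z := by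
  rw [proj, Submodule.starProjection_minimal, dist_eq_norm]
  exact ciInf_le ⟨0, by rintro _ ⟨w, rfl⟩; exact norm_nonneg _⟩ (⟨z, hz⟩ : V.1)

end Grassmann

namespace OrthGroup

variable {n k : ℕ}

theorem proj_act_apply (g : OrthGroup n) (V : Grassmann n k) (y : EuclideanSpace ℝ (Fin n)) :
    (act g V).proj (Unitary.linearIsometryEquiv g y) =
      Unitary.linearIsometryEquiv g (V.proj y) := by
  have h := Submodule.starProjection_map_apply (Unitary.linearIsometryEquiv g) V.1
    (Unitary.linearIsometryEquiv g y)
  rwa [LinearIsometryEquiv.symm_apply_apply] at h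

theorem act_mul (g h : OrthGroup n) (V : Grassmann n k) : act (g * h) V = act g (act h V) := by
  apply Grassmann.proj_injective
  simp only [proj_act, Submonoid.coe_mul, star_mul, mul_assoc]

theorem continuous_act_right (g : OrthGroup n) :
    Continuous (act g : Grassmann n k → Grassmann n k) := by
  refine continuous_induced_rng.mpr ?_
  simp only [Function.comp_def, proj_act]
  exact (continuous_const.mul Grassmann.continuous_proj).mul continuous_const

instance : (haar n).IsMulLeftInvariant :=
  inferInstanceAs (Measure.haarMeasure ⊤).IsMulLeftInvariant

theorem measurePreserving_act (hk : k ≤ n) (g : OrthGroup n) :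
    MeasurePreserving (act g) (Grassmann.gamma n k hk) (Grassmann.gamma n k hk) := by
  refine ⟨(continuous_act_right g).measurable, ?_⟩
  have horbit : Measurable fun h : OrthGroup n => act h (Grassmann.coordPlane n k hk) :=
    (continuous_act _).measurable
  calc (Grassmann.gamma n k hk).map (act g)
      = (haar n).map fun h => act (g * h) (Grassmann.coordPlane n k hk) := by
        rw [Grassmann.gamma, Measure.map_map (continuous_act_right g).measurable horbit]
        simp only [Function.comp_def, act_mul]
    _ = ((haar n).map (g * ·)).map fun h => act h (Grassmann.coordPlane n k hk) :=
        (Measure.map_map horbit (measurable_const_mul g)).symm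
    _ = Grassmann.gamma n k hk := by rw [map_mul_left_eq_self, Grassmann.gamma]

end OrthGroup

namespace Grassmann

variable {n k : ℕ}

/-- The set of `k`-planes at distance at most `r` from the point `y`; this distance is attained at
the orthogonal projection of `y`. -/
def tube (k : ℕ) (y : EuclideanSpace ℝ (Fin n)) (r : ℝ) : Set (Grassmann n k) :=
  {V | ‖y - V.proj y‖ ≤ r}

theorem tube_subset_tube_smul {c : ℝ} (hc : |c| ≤ 1) (y : EuclideanSpace ℝ (Fin n)) (r : ℝ) :
    tube k y r ⊆ tube k (c • y) r := fun V hV => by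
  rw [tube, mem_ofPred_eq, map_smul, ← smul_sub, norm_smul]
  exact (mul_le_of_le_one_left (norm_nonneg _) hc).trans hV

theorem preimage_act_tube (u : OrthGroup n) (y : EuclideanSpace ℝ (Fin n)) (r : ℝ) :
    OrthGroup.act u ⁻¹' tube k (Unitary.linearIsometryEquiv u y) r = tube k y r := by
  ext V
  simp only [tube, mem_preimage, mem_ofPred_eq, OrthGroup.proj_act_apply, ← map_sub,
    LinearIsometryEquiv.norm_map]

theorem measurableSet_mem_tube (k : ℕ) (r : ℝ) :
    MeasurableSet {p : EuclideanSpace ℝ (Fin n) × Grassmann n k | p.2 ∈ tube k p.1 r} :=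
  (isClosed_le (continuous_fst.sub continuous_proj_apply).norm continuous_const).measurableSet

theorem measurableSet_tube (y : EuclideanSpace ℝ (Fin n)) (r : ℝ) : MeasurableSet (tube k y r) :=
  measurable_prodMk_left (measurableSet_mem_tube k r)

theorem gamma_tube_eq_of_norm_eq (hk : k ≤ n) {y z : EuclideanSpace ℝ (Fin n)} (h : ‖y‖ = ‖z‖)
    (r : ℝ) : gamma n k hk (tube k y r) = gamma n k hk (tube k z r) := by
  obtain ⟨u, rfl⟩ := exists_unitary_apply_eq_of_norm_eq h
  rw [← preimage_act_tube u, (OrthGroup.measurePreserving_act hk u).measure_preimage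
    (measurableSet_tube _ r).nullMeasurableSet]

theorem gamma_tube_le_of_norm_le (hk : k ≤ n) {y z : EuclideanSpace ℝ (Fin n)} (h : ‖z‖ ≤ ‖y‖)
    (r : ℝ) : gamma n k hk (tube k y r) ≤ gamma n k hk (tube k z r) := by
  have hnorm : ‖(‖z‖ / ‖y‖) • y‖ = ‖z‖ := by
    rw [norm_smul, norm_div, norm_norm, norm_norm]
    exact div_mul_cancel_of_imp fun hy => le_antisymm (h.trans_eq hy) (norm_nonneg z)
  have hratio : |‖z‖ / ‖y‖| ≤ 1 := by
    rw [abs_of_nonneg (by positivity)]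
    exact div_le_one_of_le₀ h (norm_nonneg y)
  calc gamma n k hk (tube k y r)
      ≤ gamma n k hk (tube k ((‖z‖ / ‖y‖) • y) r) := measure_mono (tube_subset_tube_smul hratio y r)
    _ = gamma n k hk (tube k z r) := gamma_tube_eq_of_norm_eq hk hnorm r

theorem volume_closedBall_inter_tube_le (V : Grassmann n k) (R r : ℝ) :
    volume (Metric.closedBall 0 R ∩ {y | V ∈ tube k y r}) ≤
      ENNReal.ofReal (2 * R) ^ k * ENNReal.ofReal (2 * r) ^ (n - k) := by
  have hcodim : finrank ℝ V.1ᗮ = n - k := by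
    have := V.1.finrank_add_finrank_orthogonal
    rw [V.2, finrank_euclideanSpace_fin] at this
    exact Nat.eq_sub_of_add_eq' this
  have h := volume_closedBall_inter_norm_sub_starProjection_le V.1 R r
  rwa [hcodim, V.2] at h

theorem volume_closedBall_mul_gamma_tube_le (hk : k ≤ n) {y : EuclideanSpace ℝ (Fin n)} {R : ℝ}
    (hR : R ≤ ‖y‖) (r : ℝ) :
    volume (Metric.closedBall (0 : EuclideanSpace ℝ (Fin n)) R) * gamma n k hk (tube k y r) ≤
      ENNReal.ofReal (2 * R) ^ k * ENNReal.ofReal (2 * r) ^ (n - k) := by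
  set ball := Metric.closedBall (0 : EuclideanSpace ℝ (Fin n)) R
  have htube := measurableSet_mem_tube (n := n) k r
  calc volume ball * gamma n k hk (tube k y r)
      = ∫⁻ _ in ball, gamma n k hk (tube k y r) := by rw [setLIntegral_const, mul_comm]
    _ ≤ ∫⁻ z in ball, gamma n k hk (tube k z r) :=
        setLIntegral_mono' measurableSet_closedBall fun z hz =>
          gamma_tube_le_of_norm_le hk ((mem_closedBall_zero_iff.mp hz).trans hR) r
    _ = ∫⁻ V, volume.restrict ball {z | V ∈ tube k z r} ∂gamma n k hk :=
        (Measure.prod_apply htube).symm.trans (Measure.prod_apply_symm htube)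
    _ ≤ ∫⁻ _, ENNReal.ofReal (2 * R) ^ k * ENNReal.ofReal (2 * r) ^ (n - k) ∂gamma n k hk := by
        refine lintegral_mono fun V =>
          (Measure.restrict_apply (measurable_prodMk_right htube)).trans_le ?_
        rw [inter_comm]
        exact volume_closedBall_inter_tube_le V R r
    _ = ENNReal.ofReal (2 * R) ^ k * ENNReal.ofReal (2 * r) ^ (n - k) := by simp

theorem hasHittingExponent_gamma (hk : k ≤ n) {δ : ℝ} (hδ : 0 < δ) :
    HasHittingExponent (gamma n k hk) (fun V => (V.1 : Set (EuclideanSpace ℝ (Fin n))))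
      {y | δ ≤ ‖y‖} (n - k : ℕ) := by
  set v := volume (Metric.closedBall (0 : EuclideanSpace ℝ (Fin n)) δ)
  have hv : v ≠ 0 := (Metric.measure_closedBall_pos _ _ hδ).ne'
  have hv' : v ≠ ∞ := measure_closedBall_lt_top.ne
  refine ⟨ENNReal.ofReal (2 * δ) ^ k * 2 ^ (n - k) / v, by finiteness, fun E hE hdiam => ?_⟩
  rcases E.eq_empty_or_nonempty with rfl | ⟨y, hy⟩
  · simp
  have hhit : {V : Grassmann n k | (E ∩ V.1).Nonempty} ⊆ tube k y (Metric.ediam E).toReal := by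
    rintro V ⟨z, hzE, hzV⟩
    refine (norm_sub_proj_le_dist V y hzV).trans ?_
    rw [dist_edist]
    exact ENNReal.toReal_mono hdiam (Metric.edist_le_ediam_of_mem hy hzE)
  refine (measure_mono hhit).trans ?_
  rw [NNReal.coe_natCast, ENNReal.rpow_natCast, ← ENNReal.mul_div_right_comm,
    ENNReal.le_div_iff_mul_le (.inl hv) (.inl hv'), mul_comm, mul_assoc, ← mul_pow]
  simpa [ENNReal.ofReal_mul, hdiam] using
    volume_closedBall_mul_gamma_tube_le hk (hE hy) (Metric.ediam E).toReal

theorem ae_dimH_inter_le (hk : k ≤ n) (A : Set (EuclideanSpace ℝ (Fin n))) :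
    ∀ᵐ V ∂gamma n k hk,
      dimH (A ∩ (V.1 : Set (EuclideanSpace ℝ (Fin n)))) ≤ dimH A - (n - k : ℕ) := by
  let shell (j : ℕ) : Set (EuclideanSpace ℝ (Fin n)) := {y | 1 / (j + 1 : ℝ) ≤ ‖y‖}
  have hcover : A ⊆ {0} ∪ ⋃ j, A ∩ shell j := fun y hy => by
    rcases eq_or_ne y 0 with rfl | hy0
    · exact .inl rfl
    · obtain ⟨j, hj⟩ := exists_nat_one_div_lt (norm_pos_iff.mpr hy0)
      exact .inr (mem_iUnion.mpr ⟨j, hy, hj.le⟩)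
  have hshell (j : ℕ) := ((hasHittingExponent_gamma hk (δ := 1 / (j + 1 : ℝ))
    (by positivity)).mono (inter_subset_right : A ∩ shell j ⊆ _)).ae_dimH_inter_le
  filter_upwards [ae_all_iff.mpr hshell] with V hV
  calc dimH (A ∩ (V.1 : Set (EuclideanSpace ℝ (Fin n))))
      ≤ dimH ({0} ∪ ⋃ j, A ∩ shell j ∩ (V.1 : Set (EuclideanSpace ℝ (Fin n)))) := by
        refine dimH_mono fun y ⟨hyA, hyV⟩ => (hcover hyA).imp id fun hy => ?_
        rw [← iUnion_inter]
        exact ⟨hy, hyV⟩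
    _ = ⨆ j, dimH (A ∩ shell j ∩ (V.1 : Set (EuclideanSpace ℝ (Fin n)))) := by
        rw [dimH_union, dimH_singleton, dimH_iUnion, max_eq_right zero_le]
    _ ≤ dimH A - (n - k : ℕ) := iSup_le fun j =>
        (hV j).trans (tsub_le_tsub_right (dimH_mono inter_subset_left) _)

end Grassmann

/-- Truncated subtraction loses nothing here: when `dim A < n - k` almost every section
has dimension zero. -/
theorem mainTheorem8_general {n k : ℕ} (hk : k ≤ n) (A : Set (EuclideanSpace ℝ (Fin n)))
    (x : EuclideanSpace ℝ (Fin n)) :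
    ∀ᵐ V ∂Grassmann.gamma n k hk,
      dimH (A ∩ ((fun v => v + x) '' (V.1 : Set (EuclideanSpace ℝ (Fin n))))) ≤
        dimH A - (n - k : ℕ) := by
  have hinter (S : Set (EuclideanSpace ℝ (Fin n))) :
      dimH (A ∩ (fun v => v + x) '' S) = dimH ((fun v => v + x) ⁻¹' A ∩ S) := by
    rw [← image_preimage_inter, (isometry_add_right x).dimH_image]
  have hdim : dimH ((fun v => v + x) ⁻¹' A) = dimH A :=
    (IsometryEquiv.addRight x).dimH_preimage A
  simpa only [hinter, hdim] using Grassmann.ae_dimH_inter_le hk ((fun v => v + x) ⁻¹' A)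

/-- If `A ⊆ ℝⁿ` is Borel with `dim A > m`, then for all `x`, `dim (A ∩ (V + x)) ≤ dim A - m` for
`γ_{n,n-m}`-almost all `V ∈ G(n,n-m)`. -/
theorem mainTheorem8 (n m : ℕ) (hm : m ≤ n) (A : Set (EuclideanSpace ℝ (Fin n)))
    (hA : MeasurableSet A) (hdim : (m : ENNReal) < dimH A) (x : EuclideanSpace ℝ (Fin n)) :
    ∀ᵐ V ∂(Grassmann.gamma n (n - m) (Nat.sub_le n m)),
      dimH (A ∩ ((fun v => v + x) '' (V.1 : Set (EuclideanSpace ℝ (Fin n))))) ≤ dimH A - m := by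
  simpa only [Nat.sub_sub_self hm] using mainTheorem8_general (Nat.sub_le n m) A x
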